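/- Let $\mathbb{H}=\{z\in\mathbb{C}:\operatorname{Im} z>0\}$ and, for $z,w\in\mathbb{H}$, let $d(z,w)=\left|\frac{w-z}{w-\overline{z}}\right|$ be the pseudo-hyperbolic distance. Let $\phi:\mathbb{H}\to\mathbb{H}$ be analytic and of parabolic type with Denjoy–Wolff point $\infty$, meaning that for every $\theta\in(0,\pi/2)$ $$\phi(z)\to\infty\quad\text{and}\quad \frac{\phi(z)}{z}\to 1\qquad\text{as } z\to\infty \text{ in } \{z\in\mathbb{H}:|\operatorname{Arg} z-\pi/2|<\theta\}.$$ Let $(w_n)_{n\ge 0}$, $w_n=x_n+iy_n\in\mathbb{H}$, be a backward-iteration sequence with bounded steps for $\phi$: that is, $\phi(w_{n+1})=w_n$ for all $n\ge 0$, and there is a constant $c<1$ with $d(w_n,w_{n+1})\le c$ for all $n$. Let $a=\lim_{n\to\infty}d(w_n,w_{n+1})$. Assume that the sequence has non-zero height, i.e. $y_n\to\ell_\infty>0$, and that $x_n\to+\infty$. Put $$b_0=\frac{2a}{\sqrt{1-a^2}}.$$ Then $$\lim_{n\to\infty}\frac{x_{n+1}-x_n}{y_n}=b_0,$$ and $z-\phi(z)$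 has lateral limit $b_0\ell_\infty$ as $z\to+\infty$; that is, for every $R>0$ and every $0<\epsilon<1$, $$z-\phi(z)\to b_0\ell_\infty\qquad\text{as } z\to\infty \text{ in } \{x+iy:\ x\ge R,\ \epsilon\le y\le 1/\epsilon\}.$$ -/

import Mathlib

open Filter Topology

/-- The open upper half-plane, as a subset of `ℂ`. -/
def upperHalf : Set ℂ := {z | 0 < z.im}

/-- The pseudo-hyperbolic distance of the upper half-plane. -/
noncomputable def pseudoHypDist (z w : ℂ) : ℝ :=
  ‖(w - z) / (w - (starRingEnd ℂ) z)‖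

/-- The sector `|Arg z - π/2| < θ`, a non-tangential approach region for `∞` in the upper
half-plane when `0 < θ < π/2`. -/
def sector (θ : ℝ) : Set ℂ := {z | z ∈ upperHalf ∧ |Complex.arg z - Real.pi / 2| < θ}

/-- `f` tends to `l` as `z → ∞` non-tangentially in the upper half-plane. -/
def NonTangTendsto (f : ℂ → ℂ) (l : Filter ℂ) : Prop :=
  ∀ θ : ℝ, 0 < θ → θ < Real.pi / 2 → Tendsto f (Bornology.cobounded ℂ ⊓ 𝓟 (sector θ)) l

/-- `φ` is an analytic self-map of the upper half-plane of parabolic type, normalized to have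
its Denjoy-Wolff point at `∞`: `φ(z) → ∞` and `φ(z)/z → 1` as `z → ∞` non-tangentially.
Only the values of `φ` on the upper half-plane matter. -/
structure IsParabolicSelfMap (φ : ℂ → ℂ) : Prop where
  differentiableOn : DifferentiableOn ℂ φ upperHalf
  mapsTo : Set.MapsTo φ upperHalf upperHalf
  tendsto_infty : NonTangTendsto φ (Bornology.cobounded ℂ)
  tendsto_ratio : NonTangTendsto (fun z => φ z / z) (𝓝 1)

/-- `w` is a backward-iteration sequence with bounded (pseudo-hyperbolic) steps for the
self-map `φ` of the upper half-plane. -/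
structure IsBISBS (φ : ℂ → ℂ) (w : ℕ → ℂ) : Prop where
  mem : ∀ n, w n ∈ upperHalf
  backward : ∀ n, φ (w (n + 1)) = w n
  bounded : ∃ c : ℝ, c < 1 ∧ ∀ n, pseudoHypDist (w n) (w (n + 1)) ≤ c

/-- The horizontal half-strip `{x + iy : x ≥ R, ε ≤ y ≤ 1/ε}`. -/
def halfStrip (R ε : ℝ) : Set ℂ := {z | R ≤ z.re ∧ ε ≤ z.im ∧ z.im ≤ 1 / ε}

/-- `f` has lateral limit `a` at `+∞`: `f(z) → a` as `z → ∞` within each horizontal half-strip. -/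
def HasLateralLimit (f : ℂ → ℂ) (a : ℂ) : Prop :=
  ∀ R ε : ℝ, 0 < R → 0 < ε → ε < 1 →
    Tendsto f (Bornology.cobounded ℂ ⊓ 𝓟 (halfStrip R ε)) (𝓝 a)

open ComplexConjugate

/-! Julia's lemma gives `Im φ(z) ≥ Im z`, so `p = φ - id` takes values in the closed upper
half-plane. A Harnack-type estimate then bounds the oscillation of `p` over a hyperbolic disc by `Im
p` at its centre. Along the orbit, `p (w (n + 1)) = w n - w (n + 1)` has imaginary part tending to
`0`, so `p` is almost constant near `w n`. Strip points far to the right stay within a fixed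
hyperbolic distance of the orbit, so `z - φ z` inherits the limit of `x (n + 1) - x n`.

The distance formula yields the limit of `|x (n + 1) - x n|`. For the sign, Schwarz–Pick makes `d (w
n) (w (n + 2))` nondecreasing in `n`; reversals of direction at arbitrarily late times would force
it towards `0`. Hence the direction is eventually fixed, and `x n → +∞` makes it positive. -/

/-! ### Pseudo-hyperbolic distance and Schwarz–Pick -/

lemma denom_pos {z w : ℂ} (hz : z ∈ upperHalf) (hw : w ∈ upperHalf) :
    0 < (w.re - z.re) ^ 2 + (w.im + z.im) ^ 2 := by
  have h1 : 0 < z.im := hz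
  have h2 : 0 < w.im := hw
  positivity

lemma sub_conj_ne_zero {z w : ℂ} (hz : z ∈ upperHalf) (hw : w ∈ upperHalf) :
    w - conj z ≠ 0 := by
  have h1 : 0 < z.im := hz
  have h2 : 0 < w.im := hw
  intro h
  have := congrArg Complex.im h
  simp at this
  linarith

lemma pseudoHypDist_nonneg (z w : ℂ) : 0 ≤ pseudoHypDist z w := norm_nonneg _

lemma pseudoHypDist_comm (z w : ℂ) : pseudoHypDist z w = pseudoHypDist w z := by
  unfold pseudoHypDist
  rw [norm_div, norm_div, norm_sub_rev w z, ← Complex.norm_conj (w - conj z), map_sub,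
    Complex.conj_conj, norm_sub_rev (conj w)]

lemma pseudoHypDist_sq (z w : ℂ) :
    pseudoHypDist z w ^ 2 = ((w.re - z.re) ^ 2 + (w.im - z.im) ^ 2) /
      ((w.re - z.re) ^ 2 + (w.im + z.im) ^ 2) := by
  unfold pseudoHypDist
  rw [norm_div, div_pow, ← Complex.normSq_eq_norm_sq, ← Complex.normSq_eq_norm_sq,
    Complex.normSq_apply, Complex.normSq_apply]
  simp
  ring_nf

lemma one_sub_pseudoHypDist_sq {z w : ℂ} (hz : z ∈ upperHalf) (hw : w ∈ upperHalf) :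
    1 - pseudoHypDist z w ^ 2 =
      4 * z.im * w.im / ((w.re - z.re) ^ 2 + (w.im + z.im) ^ 2) := by
  have := denom_pos hz hw
  rw [pseudoHypDist_sq, eq_div_iff this.ne', sub_mul, div_mul_cancel₀ _ this.ne']
  ring

lemma pseudoHypDist_lt_one {z w : ℂ} (hz : z ∈ upperHalf) (hw : w ∈ upperHalf) :
    pseudoHypDist z w < 1 := by
  have h := one_sub_pseudoHypDist_sq hz hw
  have h0 := denom_pos hz hw
  have h1 : 0 < z.im := hz
  have h2 : 0 < w.im := hw
  have h3 : 0 < 1 - pseudoHypDist z w ^ 2 := by rw [h]; positivity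
  nlinarith [pseudoHypDist_nonneg z w]

/-- The inverse of the Cayley transform centred at `z`. -/
noncomputable def invCayley (z ζ : ℂ) : ℂ := (z - conj z * ζ) / (1 - ζ)

lemma one_sub_ne_zero_of_norm_lt_one {ζ : ℂ} (hζ : ‖ζ‖ < 1) : 1 - ζ ≠ 0 := by
  intro h
  rw [← sub_eq_zero.1 h] at hζ
  simp at hζ

lemma invCayley_mem {z ζ : ℂ} (hz : z ∈ upperHalf) (hζ : ‖ζ‖ < 1) :
    invCayley z ζ ∈ upperHalf := by
  have h1 : 0 < z.im := hz
  have hne := one_sub_ne_zero_of_norm_lt_one hζ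
  have h2 : Complex.normSq ζ < 1 := by
    rw [Complex.normSq_eq_norm_sq]
    nlinarith [norm_nonneg ζ]
  rw [Complex.normSq_apply] at h2
  have h3 : 0 < Complex.normSq (1 - ζ) := Complex.normSq_pos.2 hne
  change 0 < (invCayley z ζ).im
  unfold invCayley
  rw [Complex.div_im, ← sub_div]
  apply div_pos _ h3
  simp
  nlinarith

/-- The **Schwarz–Pick lemma** on the upper half-plane. -/
theorem pseudoHypDist_map_le {f : ℂ → ℂ} (hf : DifferentiableOn ℂ f upperHalf)
    (hm : Set.MapsTo f upperHalf upperHalf) {z w : ℂ} (hz : z ∈ upperHalf)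
    (hw : w ∈ upperHalf) : pseudoHypDist (f z) (f w) ≤ pseudoHypDist z w := by
  -- Conjugating by Cayley transforms centred at `z` and `f z` gives a disc map fixing `0`, to which
  -- the classical Schwarz lemma applies.
  set g : ℂ → ℂ := fun ζ => (f (invCayley z ζ) - f z) / (f (invCayley z ζ) - conj (f z)) with hg
  have hball : ∀ {ζ : ℂ}, ζ ∈ Metric.ball (0 : ℂ) 1 → ‖ζ‖ < 1 := fun h => by simpa using h
  have hinv : DifferentiableOn ℂ (fun ζ => invCayley z ζ) (Metric.ball 0 1) := by
    unfold invCayley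
    exact DifferentiableOn.div (by fun_prop) (by fun_prop)
      fun ζ hζ => one_sub_ne_zero_of_norm_lt_one (hball hζ)
  have hfi : DifferentiableOn ℂ (fun ζ => f (invCayley z ζ)) (Metric.ball 0 1) :=
    hf.comp hinv fun ζ hζ => invCayley_mem hz (hball hζ)
  have hgd : DifferentiableOn ℂ g (Metric.ball 0 1) :=
    (hfi.sub_const _).div (hfi.sub_const _)
      fun ζ hζ => sub_conj_ne_zero (hm hz) (hm (invCayley_mem hz (hball hζ)))
  have hgm : Set.MapsTo g (Metric.ball 0 1) (Metric.closedBall 0 1) := by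
    intro ζ hζ
    rw [mem_closedBall_zero_iff]
    exact (pseudoHypDist_lt_one (hm hz) (hm (invCayley_mem hz (hball hζ)))).le
  have hg0 : g 0 = 0 := by simp [hg, invCayley]
  have hlt : ‖(w - z) / (w - conj z)‖ < 1 := pseudoHypDist_lt_one hz hw
  have key := Complex.norm_le_norm_of_mapsTo_ball hgd hgm hg0 hlt
  have hne := sub_conj_ne_zero hz hw
  have hzz := sub_conj_ne_zero hz hz
  have hback : invCayley z ((w - z) / (w - conj z)) = w := by
    have h1 := one_sub_ne_zero_of_norm_lt_one hlt
    unfold invCayley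
    rw [div_eq_iff h1]
    field_simp
    ring
  simp only [hg, hback] at key
  exact key

/-- Schwarz–Pick in terms of imaginary parts. -/
lemma im_mul_im_div_le {f : ℂ → ℂ} (hf : DifferentiableOn ℂ f upperHalf)
    (hm : Set.MapsTo f upperHalf upperHalf) {z w : ℂ} (hz : z ∈ upperHalf)
    (hw : w ∈ upperHalf) :
    z.im * w.im / ((w.re - z.re) ^ 2 + (w.im + z.im) ^ 2) ≤
      (f z).im * (f w).im / (((f w).re - (f z).re) ^ 2 + ((f w).im + (f z).im) ^ 2) := by
  have h := pseudoHypDist_map_le hf hm hz hw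
  have h1 := one_sub_pseudoHypDist_sq hz hw
  have h2 := one_sub_pseudoHypDist_sq (hm hz) (hm hw)
  have h3 := pow_le_pow_left₀ (pseudoHypDist_nonneg _ _) h 2
  rw [mul_assoc, mul_div_assoc] at h1 h2
  linarith

/-! ### Julia's lemma and a Harnack estimate -/

/-- **Julia's lemma** for a parabolic self-map with Denjoy–Wolff point `∞`. -/
theorem IsParabolicSelfMap.im_le {φ : ℂ → ℂ} (hφ : IsParabolicSelfMap φ) {z : ℂ}
    (hz : z ∈ upperHalf) : z.im ≤ (φ z).im := by
  have hit : Tendsto (fun t : ℝ => (t : ℂ) * Complex.I) atTop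
      (Bornology.cobounded ℂ ⊓ 𝓟 (sector (Real.pi / 4))) := by
    refine tendsto_inf.2 ⟨?_, tendsto_principal.2 ?_⟩
    · rw [← tendsto_norm_atTop_iff_cobounded]
      refine tendsto_abs_atTop_atTop.congr fun t => ?_
      simp
    · filter_upwards [eventually_gt_atTop 0] with t ht
      refine ⟨by simpa [upperHalf] using ht, ?_⟩
      rw [Complex.arg_real_mul _ ht, Complex.arg_I]
      simp [Real.pi_pos]
  have hr := (hφ.tendsto_ratio (Real.pi / 4) (by positivity)
    (by linarith [Real.pi_pos])).comp hit
  have hr' : Tendsto (fun t : ℝ => φ (t * Complex.I) / t) atTop (𝓝 Complex.I) := by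
    have := hr.mul_const Complex.I
    rw [one_mul] at this
    refine this.congr' ?_
    filter_upwards [eventually_gt_atTop 0] with t ht
    have : (t : ℂ) ≠ 0 := by exact_mod_cast ht.ne'
    simp only [Function.comp]
    field_simp
  have hre : Tendsto (fun t : ℝ => (φ (t * Complex.I)).re / t) atTop (𝓝 0) := by
    have := (Complex.continuous_re.tendsto _).comp hr'
    simpa [Function.comp_def] using this
  have him : Tendsto (fun t : ℝ => (φ (t * Complex.I)).im / t) atTop (𝓝 1) := by
    have := (Complex.continuous_im.tendsto _).comp hr'
    simpa [Function.comp_def] using this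
  have hc : ∀ c : ℝ, Tendsto (fun t : ℝ => c / t) atTop (𝓝 0) :=
    fun c => tendsto_const_nhds.div_atTop tendsto_id
  have hL : Tendsto (fun t : ℝ => z.im / ((z.re / t) ^ 2 + (1 + z.im / t) ^ 2)) atTop
      (𝓝 (z.im / (0 ^ 2 + (1 + 0) ^ 2))) :=
    tendsto_const_nhds.div (((hc _).pow 2).add ((tendsto_const_nhds.add (hc _)).pow 2))
      (by norm_num)
  have hR : Tendsto (fun t : ℝ => (φ z).im * ((φ (t * Complex.I)).im / t) /
      (((φ (t * Complex.I)).re / t - (φ z).re / t) ^ 2 +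
        ((φ (t * Complex.I)).im / t + (φ z).im / t) ^ 2)) atTop
      (𝓝 ((φ z).im * 1 / ((0 - 0) ^ 2 + (1 + 0) ^ 2))) :=
    (tendsto_const_nhds.mul him).div
      (((hre.sub (hc _)).pow 2).add ((him.add (hc _)).pow 2)) (by norm_num)
  have hle := le_of_tendsto_of_tendsto hL hR ?_
  · simpa using hle
  filter_upwards [eventually_gt_atTop 0] with t ht
  have hmem : (t : ℂ) * Complex.I ∈ upperHalf := by simpa [upperHalf] using ht
  have h := im_mul_im_div_le hφ.differentiableOn hφ.mapsTo hz hmem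
  have hd1 := denom_pos hz hmem
  have hd2 := denom_pos (hφ.mapsTo hz) (hφ.mapsTo hmem)
  -- Both sides of Schwarz–Pick for `z` and `it` decay like `1 / t`; after multiplication by `t`
  -- they tend to `z.im` and `(φ z).im`.
  have hmul := mul_le_mul_of_nonneg_left h ht.le
  simp only [Complex.mul_re, Complex.mul_im, Complex.ofReal_re, Complex.ofReal_im,
    Complex.I_re, Complex.I_im, mul_zero, mul_one, sub_zero, zero_sub, add_zero]
    at hmul hd1
  set u := (φ (t * Complex.I)).re
  set v := (φ (t * Complex.I)).im
  have e1 : z.im / ((z.re / t) ^ 2 + (1 + z.im / t) ^ 2) =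
      t * (z.im * t / ((-z.re) ^ 2 + (t + z.im) ^ 2)) := by
    have : (z.re / t) ^ 2 + (1 + z.im / t) ^ 2 = ((-z.re) ^ 2 + (t + z.im) ^ 2) / t ^ 2 := by
      field_simp
    rw [this, div_div_eq_mul_div]
    ring
  have e2 : (φ z).im * (v / t) / ((u / t - (φ z).re / t) ^ 2 + (v / t + (φ z).im / t) ^ 2) =
      t * ((φ z).im * v / ((u - (φ z).re) ^ 2 + (v + (φ z).im) ^ 2)) := by
    have : (u / t - (φ z).re / t) ^ 2 + (v / t + (φ z).im / t) ^ 2 =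
        ((u - (φ z).re) ^ 2 + (v + (φ z).im) ^ 2) / t ^ 2 := by
      field_simp
    rw [this, div_div_eq_mul_div, mul_div_assoc']
    field_simp
  rw [e1, e2]
  exact hmul

/-- A Harnack-type estimate for functions with values in the closed upper half-plane. -/
theorem norm_sub_le_of_im_nonneg {p : ℂ → ℂ} (hp : DifferentiableOn ℂ p upperHalf)
    (him : ∀ z ∈ upperHalf, 0 ≤ (p z).im) {z w : ℂ} (hz : z ∈ upperHalf)
    (hw : w ∈ upperHalf) {r : ℝ} (hr : r < 1) (hd : pseudoHypDist z w ≤ r) :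
    ‖p z - p w‖ ≤ 2 * r / (1 - r) * (p w).im := by
  have hr0 : 0 ≤ r := (pseudoHypDist_nonneg _ _).trans hd
  have h1r : 0 < 1 - r := by linarith
  -- Schwarz–Pick needs the open half-plane: shift by `iδ`, then let `δ → 0`.
  have key : ∀ δ : ℝ, 0 < δ → ‖p z - p w‖ ≤ 2 * r / (1 - r) * ((p w).im + δ) := by
    intro δ hδ
    set f : ℂ → ℂ := fun ζ => p ζ + δ * Complex.I with hf
    have hfd : DifferentiableOn ℂ f upperHalf := hp.add_const _
    have hfm : Set.MapsTo f upperHalf upperHalf := by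
      intro ζ hζ
      have := him ζ hζ
      simp only [hf, upperHalf, Set.mem_ofPred_eq]
      simp
      linarith
    have h := (pseudoHypDist_map_le hfd hfm hw hz).trans ((pseudoHypDist_comm w z).trans_le hd)
    have hne := sub_conj_ne_zero (hfm hw) (hfm hz)
    rw [pseudoHypDist, norm_div, div_le_iff₀ (norm_pos_iff.2 hne)] at h
    have e : f z - conj (f w) = (f z - f w) + ((2 * (f w).im : ℝ) : ℂ) * Complex.I := by
      rw [← Complex.sub_conj]
      ring
    have hfw : 0 < (f w).im := hfm hw
    have h2 : ‖f z - conj (f w)‖ ≤ ‖f z - f w‖ + 2 * (f w).im := by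
      rw [e]
      refine (norm_add_le _ _).trans_eq ?_
      rw [norm_mul, Complex.norm_real, Complex.norm_I, mul_one, Real.norm_of_nonneg (by linarith)]
    have h3 : f z - f w = p z - p w := by simp [hf]
    have h4 : (f w).im = (p w).im + δ := by simp [hf]
    rw [h3] at h h2
    rw [h4] at h2
    -- With `D = ‖p z - p w‖`, the bound `D ≤ r (D + 2 Im f(w))` is solved for `D`.
    rw [div_mul_eq_mul_div, le_div_iff₀ h1r]
    nlinarith [mul_le_mul_of_nonneg_left h2 hr0]
  have hlim : Tendsto (fun δ : ℝ => 2 * r / (1 - r) * ((p w).im + δ)) (𝓝[>] 0)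
      (𝓝 (2 * r / (1 - r) * ((p w).im + 0))) :=
    ((continuous_const.mul (continuous_const.add continuous_id)).tendsto 0).mono_left
      nhdsWithin_le_nhds
  rw [add_zero] at hlim
  exact ge_of_tendsto hlim (by filter_upwards [self_mem_nhdsWithin] with δ hδ using key δ hδ)

/-! ### Step sizes and direction of the orbit -/

lemma IsBISBS.pseudoHypDist_mono {φ : ℂ → ℂ} (hφ : IsParabolicSelfMap φ) {w : ℕ → ℂ}
    (hw : IsBISBS φ w) (k : ℕ) : Monotone fun n => pseudoHypDist (w n) (w (n + k)) := by
  refine monotone_nat_of_le_succ fun n => ?_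
  have h := pseudoHypDist_map_le hφ.differentiableOn hφ.mapsTo (hw.mem (n + 1))
    (hw.mem (n + 1 + k))
  rwa [hw.backward, add_right_comm, hw.backward, add_right_comm] at h

lemma eq_of_pseudoHypDist_eq_zero {z w : ℂ} (hz : z ∈ upperHalf) (hw : w ∈ upperHalf)
    (h : pseudoHypDist z w = 0) : w = z := by
  rw [pseudoHypDist, norm_eq_zero, div_eq_zero_iff] at h
  exact sub_eq_zero.1 (h.resolve_right (sub_conj_ne_zero hz hw))

/-- The step sizes of a backward orbit of non-zero height converge. -/
lemma tendsto_abs_re_sub {w : ℕ → ℂ} (hmem : ∀ n, w n ∈ upperHalf) {a ℓ : ℝ} (ha0 : 0 ≤ a)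
    (ha1 : a < 1) (ha : Tendsto (fun n => pseudoHypDist (w n) (w (n + 1))) atTop (𝓝 a))
    (hℓ : Tendsto (fun n => (w n).im) atTop (𝓝 ℓ)) (hℓ_pos : 0 < ℓ) :
    Tendsto (fun n => |(w (n + 1)).re - (w n).re|) atTop
      (𝓝 (2 * a / Real.sqrt (1 - a ^ 2) * ℓ)) := by
  have hs : 0 < 1 - a ^ 2 := by nlinarith
  have hℓ' := hℓ.comp (tendsto_add_atTop_nat 1)
  have hsq : Tendsto (fun n => ((w (n + 1)).re - (w n).re) ^ 2) atTop
      (𝓝 ((a ^ 2 * (ℓ + ℓ) ^ 2 - (ℓ - ℓ) ^ 2) / (1 - a ^ 2))) := by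
    -- The formula for the squared distance `d²` is solved for the horizontal step: `(Δx)² (1 - d²)
    -- = d² (y + y')² - (y' - y)²`.
    refine ((((ha.pow 2).mul ((hℓ'.add hℓ).pow 2)).sub ((hℓ'.sub hℓ).pow 2)).div
      (tendsto_const_nhds.sub (ha.pow 2)) hs.ne').congr fun n => ?_
    have hlt := pseudoHypDist_lt_one (hmem n) (hmem (n + 1))
    have h0 := pseudoHypDist_nonneg (w n) (w (n + 1))
    have hne : 0 < 1 - pseudoHypDist (w n) (w (n + 1)) ^ 2 := by nlinarith
    have hden := denom_pos (hmem n) (hmem (n + 1))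
    have h := pseudoHypDist_sq (w n) (w (n + 1))
    rw [eq_div_iff hden.ne'] at h
    simp only [Function.comp, Pi.div_apply]
    rw [div_eq_iff hne.ne']
    linarith
  have := hsq.sqrt
  simp only [Real.sqrt_sq_eq_abs] at this
  convert this using 2
  rw [show (a ^ 2 * (ℓ + ℓ) ^ 2 - (ℓ - ℓ) ^ 2) / (1 - a ^ 2) = (2 * a * ℓ) ^ 2 / (1 - a ^ 2) by ring,
    Real.sqrt_div' _ hs.le, Real.sqrt_sq (by positivity)]
  ring

/-- A sequence that tends to `+∞` and whose increments eventually keep their sign is eventually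
strictly increasing. -/
lemma eventually_increment_pos {x : ℕ → ℝ} (hx : Tendsto x atTop atTop)
    (h : ∀ᶠ n in atTop, 0 < (x (n + 1) - x n) * (x (n + 2) - x (n + 1))) :
    ∀ᶠ n in atTop, 0 < x (n + 1) - x n := by
  obtain ⟨N, hN⟩ := eventually_atTop.1 h
  have hex : ∃ m, N ≤ m ∧ 0 < x (m + 1) - x m := by
    by_contra! hcon
    have hle : ∀ m, N ≤ m → x m ≤ x N := by
      intro m hm
      induction m, hm using Nat.le_induction with
      | base => exact le_rfl
      | succ m hm ih => linarith [hcon m hm]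
    obtain ⟨m, hm1, hm2⟩ := ((hx.eventually_gt_atTop (x N)).and (eventually_ge_atTop N)).exists
    exact absurd (hle m hm2) (not_le.2 hm1)
  obtain ⟨m, hNm, hm⟩ := hex
  filter_upwards [eventually_ge_atTop m] with n hn
  induction n, hn using Nat.le_induction with
  | base => exact hm
  | succ n hn ih => exact (pos_iff_pos_of_mul_pos (hN n (hNm.trans hn))).1 ih

/-- Consecutive steps of a backward orbit going to `+∞` at non-zero height eventually have the
same direction. -/
lemma IsBISBS.eventually_re_sub_mul_pos {φ : ℂ → ℂ} (hφ : IsParabolicSelfMap φ) {w : ℕ → ℂ}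
    (hw : IsBISBS φ w) {ℓ L : ℝ} (hℓ : Tendsto (fun n => (w n).im) atTop (𝓝 ℓ))
    (hℓ_pos : 0 < ℓ) (hx : Tendsto (fun n => (w n).re) atTop atTop)
    (habs : Tendsto (fun n => |(w (n + 1)).re - (w n).re|) atTop (𝓝 L)) :
    ∀ᶠ n in atTop,
      0 < ((w (n + 1)).re - (w n).re) * ((w (n + 2)).re - (w (n + 1)).re) := by
  have hN : ∃ N, 0 < pseudoHypDist (w N) (w (N + 2)) := by
    by_contra! hcon
    have heq : ∀ n, w (n + 2) = w n := fun n =>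
      eq_of_pseudoHypDist_eq_zero (hw.mem _) (hw.mem _)
        ((hcon n).antisymm (pseudoHypDist_nonneg _ _))
    have hconst : ∀ n, w (2 * n) = w 0 := by
      intro n
      induction n with
      | zero => rfl
      | succ n ih => rw [mul_add, mul_one, heq, ih]
    obtain ⟨N, hN⟩ := eventually_atTop.1 (hx.eventually_gt_atTop (w 0).re)
    have := hN (2 * N) (by omega)
    rw [hconst] at this
    exact lt_irrefl _ this
  obtain ⟨N, hN⟩ := hN
  set δ := pseudoHypDist (w N) (w (N + 2))
  have hℓ2 := hℓ.comp (tendsto_add_atTop_nat 2)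
  have habs1 := habs.comp (tendsto_add_atTop_nat 1)
  -- When consecutive steps have opposite signs, `||B| - |A||` is the two-step displacement `|A +
  -- B|`, so negativity here contradicts `δ ≤ d (w n) (w (n + 2))`.
  have hsmall : Tendsto (fun n => (|(w (n + 2)).re - (w (n + 1)).re| -
      |(w (n + 1)).re - (w n).re|) ^ 2 + ((w (n + 2)).im - (w n).im) ^ 2 -
      δ ^ 2 * ((w (n + 2)).im + (w n).im) ^ 2) atTop
      (𝓝 ((L - L) ^ 2 + (ℓ - ℓ) ^ 2 - δ ^ 2 * (ℓ + ℓ) ^ 2)) :=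
    (((habs1.sub habs).pow 2).add ((hℓ2.sub hℓ).pow 2)).sub
      (((hℓ2.add hℓ).pow 2).const_mul (δ ^ 2))
  have hneg : (L - L) ^ 2 + (ℓ - ℓ) ^ 2 - δ ^ 2 * (ℓ + ℓ) ^ 2 < 0 := by
    have : 0 < δ ^ 2 * (ℓ + ℓ) ^ 2 := by positivity
    simpa using this
  filter_upwards [hsmall.eventually_lt_const hneg, eventually_ge_atTop N] with n hn hNn
  by_contra! hcon
  have hd : δ ≤ pseudoHypDist (w n) (w (n + 2)) := hw.pseudoHypDist_mono hφ 2 hNn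
  have hd2 := pow_le_pow_left₀ hN.le hd 2
  rw [pseudoHypDist_sq (w n), le_div_iff₀ (denom_pos (hw.mem _) (hw.mem _))] at hd2
  set A := (w (n + 1)).re - (w n).re
  set B := (w (n + 2)).re - (w (n + 1)).re
  have hAB : (w (n + 2)).re - (w n).re = A + B := by ring
  rw [hAB] at hd2
  have hsq : (|B| - |A|) ^ 2 = (A + B) ^ 2 := by
    have h1 : |B| * |A| = -(A * B) := by rw [← abs_mul, mul_comm, abs_of_nonpos hcon]
    nlinarith [sq_abs A, sq_abs B]
  rw [hsq] at hn
  have h4 : 0 ≤ δ ^ 2 * (A + B) ^ 2 := by positivity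
  linarith

/-! ### Passage from the orbit to the strip -/

/-- Points of horizontal strips are close to the sequence `x`, with index as large as we please. -/
lemma exists_index_near {x : ℕ → ℝ} (hx : Tendsto x atTop atTop) {K : ℕ} {M : ℝ}
    (hM : ∀ n, K ≤ n → |x (n + 1) - x n| ≤ M) {s : ℝ} (hs : x K ≤ s) :
    ∃ n, K ≤ n ∧ |x n - s| ≤ M := by
  have hex : ∃ k, s < x (K + k) := by
    obtain ⟨n, hn1, hn2⟩ := ((hx.eventually_gt_atTop s).and (eventually_ge_atTop K)).exists
    exact ⟨n - K, by rwa [Nat.add_sub_cancel' hn2]⟩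
  classical
  -- The index just before the first passage beyond `s`: the step from it straddles `s`.
  obtain ⟨j, hj⟩ : ∃ j, Nat.find hex = j + 1 := by
    refine Nat.exists_eq_succ_of_ne_zero fun h0 => ?_
    have := Nat.find_spec hex
    rw [h0] at this
    exact absurd hs (not_le.2 this)
  have h1 := Nat.find_spec hex
  rw [hj] at h1
  have h2 := not_lt.1 (Nat.find_min hex (m := j) (by omega))
  have h3 := hM (K + j) (by omega)
  rw [← add_assoc] at h1
  refine ⟨K + j, by omega, ?_⟩
  rw [abs_le] at h3 ⊢
  constructor <;> linarith [h3.2]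

/-- A uniform bound for the pseudo-hyperbolic distance on boxes. -/
lemma exists_pseudoHypDist_le {m Y M : ℝ} (hm : 0 < m) (hY : 0 < Y) :
    ∃ r < 1, ∀ z w : ℂ, m ≤ z.im → m ≤ w.im → z.im ≤ Y → w.im ≤ Y → |w.re - z.re| ≤ M →
      pseudoHypDist z w ≤ r := by
  -- In `1 - d²`, take the smallest numerator and the largest denominator on the box.
  refine ⟨Real.sqrt (1 - 4 * m * m / (M ^ 2 + (Y + Y) ^ 2)), ?_, ?_⟩
  · rw [Real.sqrt_lt' one_pos]
    have : 0 < 4 * m * m / (M ^ 2 + (Y + Y) ^ 2) := by positivity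
    linarith
  · intro z w hz hw hzY hwY hM
    have hz' : z ∈ upperHalf := hm.trans_le hz
    have hw' : w ∈ upperHalf := hm.trans_le hw
    apply Real.le_sqrt_of_sq_le
    have h := one_sub_pseudoHypDist_sq hz' hw'
    have hle : 4 * m * m / (M ^ 2 + (Y + Y) ^ 2) ≤
        4 * z.im * w.im / ((w.re - z.re) ^ 2 + (w.im + z.im) ^ 2) := by
      have h1 : (w.re - z.re) ^ 2 ≤ M ^ 2 := sq_le_sq' (by linarith [(abs_le.1 hM).1]) (abs_le.1 hM).2
      have := denom_pos hz' hw'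
      have hz0 : 0 < z.im := hz'
      have hw0 : 0 < w.im := hw'
      gcongr
    linarith

lemma tendsto_re_halfStrip (R ε : ℝ) (hR : 0 < R) (hε : 0 < ε) :
    Tendsto Complex.re (Bornology.cobounded ℂ ⊓ 𝓟 (halfStrip R ε)) atTop := by
  have h1 : Tendsto (fun z : ℂ => ‖z‖ - 1 / ε)
      (Bornology.cobounded ℂ ⊓ 𝓟 (halfStrip R ε)) atTop :=
    tendsto_atTop_add_const_right _ _ (tendsto_norm_cobounded_atTop.mono_left inf_le_left)
  refine tendsto_atTop_mono' _ ?_ h1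
  filter_upwards [mem_inf_of_right (mem_principal_self _)] with z hz
  obtain ⟨h1, h2, h3⟩ := hz
  have := Complex.norm_le_abs_re_add_abs_im z
  rw [abs_of_nonneg (hR.le.trans h1), abs_of_nonneg (hε.le.trans h2)] at this
  linarith

/-- If the increments of `φ` along a backward orbit going to `+∞` at non-zero height converge to a
real number, then this number is the lateral limit of `z - φ z`. -/
theorem IsBISBS.hasLateralLimit {φ : ℂ → ℂ} (hφ : IsParabolicSelfMap φ) {w : ℕ → ℂ}
    (hw : IsBISBS φ w) {ℓ L : ℝ} (hℓ : Tendsto (fun n => (w n).im) atTop (𝓝 ℓ))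
    (hℓ_pos : 0 < ℓ) (hx : Tendsto (fun n => (w n).re) atTop atTop)
    (hL : Tendsto (fun n => (w (n + 1)).re - (w n).re) atTop (𝓝 L)) :
    HasLateralLimit (fun z => z - φ z) (L : ℂ) := by
  intro R ε hR hε hε1
  set p : ℂ → ℂ := fun z => φ z - z with hp
  have hpd : DifferentiableOn ℂ p upperHalf := hφ.differentiableOn.sub differentiableOn_id
  have hpim : ∀ z ∈ upperHalf, 0 ≤ (p z).im := fun z hz => by
    simpa [hp] using hφ.im_le hz
  have hpre : Tendsto (fun n => (p (w (n + 1))).re) atTop (𝓝 (-L)) := by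
    refine hL.neg.congr fun n => ?_
    simp [hp, hw.backward]
  have hpi : Tendsto (fun n => (p (w (n + 1))).im) atTop (𝓝 0) := by
    rw [← sub_self ℓ]
    refine (hℓ.sub (hℓ.comp (tendsto_add_atTop_nat 1))).congr fun n => ?_
    simp [hp, hw.backward]
  -- Heights between `m` and `Y` cover both the strip and a tail of the orbit, so one `r < 1` serves
  -- all pairs used below.
  set m := min (ℓ / 2) ε
  set Y := max (ℓ + 1) (1 / ε)
  have hm : 0 < m := lt_min (by linarith) hε
  have hY : 0 < Y := lt_max_of_lt_left (by linarith)
  obtain ⟨r, hr1, hr⟩ := exists_pseudoHypDist_le (M := |L| + 1) hm hY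
  have herr : Tendsto (fun n => 2 * r / (1 - r) * (p (w n)).im + ‖p (w n) + L‖) atTop (𝓝 0) := by
    rw [← tendsto_add_atTop_iff_nat 1]
    have hc : Tendsto (fun n => p (w (n + 1)) + L) atTop (𝓝 0) := by
      have h1 : Tendsto (fun n => (((p (w (n + 1))).re + L : ℝ) : ℂ) +
          ((p (w (n + 1))).im : ℂ) * Complex.I) atTop
          (𝓝 (((-L + L : ℝ) : ℂ) + ((0 : ℝ) : ℂ) * Complex.I)) :=
        ((Complex.continuous_ofReal.tendsto _).comp (hpre.add_const L)).add
          (((Complex.continuous_ofReal.tendsto _).comp hpi).mul_const _)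
      simp only [neg_add_cancel, Complex.ofReal_zero, zero_mul, add_zero] at h1
      refine h1.congr fun n => ?_
      apply Complex.ext <;> simp
    simpa using (hpi.const_mul (2 * r / (1 - r))).add hc.norm
  rw [Metric.tendsto_nhds]
  intro η hη
  have hev : ∀ᶠ n in atTop, 2 * r / (1 - r) * (p (w n)).im + ‖p (w n) + L‖ < η ∧
      |(w (n + 1)).re - (w n).re| ≤ |L| + 1 ∧ ℓ / 2 ≤ (w n).im ∧ (w n).im ≤ ℓ + 1 := by
    filter_upwards [herr.eventually_lt_const hη, hL.abs.eventually_le_const (lt_add_one _),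
      hℓ.eventually_const_le (half_lt_self hℓ_pos), hℓ.eventually_le_const (lt_add_one _)]
      with n h1 h2 h3 h4 using ⟨h1, h2, h3, h4⟩
  obtain ⟨K, hK⟩ := eventually_atTop.1 hev
  filter_upwards [mem_inf_of_right (mem_principal_self _),
    (tendsto_re_halfStrip R ε hR hε).eventually_ge_atTop (w K).re] with z hz hzK
  obtain ⟨-, hz1, hz2⟩ := hz
  obtain ⟨n, hKn, hn⟩ := exists_index_near hx (fun n hn => (hK n hn).2.1) hzK
  obtain ⟨h1, -, h3, h4⟩ := hK n hKn
  have hd := hr z (w n) ((min_le_right _ _).trans hz1) ((min_le_left _ _).trans h3)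
    (hz2.trans (le_max_right _ _)) (h4.trans (le_max_left _ _)) hn
  have hzm : z ∈ upperHalf := hε.trans_le hz1
  have hest := norm_sub_le_of_im_nonneg hpd hpim hzm (hw.mem n) hr1 hd
  rw [dist_eq_norm, show z - φ z - L = -((p z - p (w n)) + (p (w n) + L)) by simp only [hp]; ring,
    norm_neg]
  exact ((norm_add_le _ _).trans (add_le_add_left hest _)).trans_lt h1

theorem proposition1p18 (φ : ℂ → ℂ) (hφ : IsParabolicSelfMap φ)
    (w : ℕ → ℂ) (hw : IsBISBS φ w)
    (a : ℝ) (ha : Tendsto (fun n => pseudoHypDist (w n) (w (n + 1))) atTop (𝓝 a))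
    (ℓ : ℝ) (hℓ : Tendsto (fun n => (w n).im) atTop (𝓝 ℓ)) (hℓ_pos : 0 < ℓ)
    (hx : Tendsto (fun n => (w n).re) atTop atTop)
    (b₀ : ℝ) (hb₀ : b₀ = 2 * a / Real.sqrt (1 - a ^ 2)) :
    Tendsto (fun n => ((w (n + 1)).re - (w n).re) / (w n).im) atTop (𝓝 b₀) ∧
      HasLateralLimit (fun z => z - φ z) ((b₀ * ℓ : ℝ) : ℂ) := by
  have ha0 : 0 ≤ a := ge_of_tendsto' ha fun n => pseudoHypDist_nonneg _ _
  obtain ⟨c, hc, hdc⟩ := hw.bounded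
  have ha1 : a < 1 := (le_of_tendsto' ha hdc).trans_lt hc
  have habs := tendsto_abs_re_sub hw.mem ha0 ha1 ha hℓ hℓ_pos
  rw [← hb₀] at habs
  have hpos := eventually_increment_pos hx (hw.eventually_re_sub_mul_pos hφ hℓ hℓ_pos hx habs)
  have hL : Tendsto (fun n => (w (n + 1)).re - (w n).re) atTop (𝓝 (b₀ * ℓ)) := by
    refine habs.congr' ?_
    filter_upwards [hpos] with n hn using abs_of_pos hn
  refine ⟨?_, hw.hasLateralLimit hφ hℓ hℓ_pos hx hL⟩
  have := hL.div hℓ hℓ_pos.ne'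
  rwa [mul_div_cancel_right₀ _ hℓ_pos.ne'] at this
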